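/- Let $F=(F_s)_{s\ge 0}$ be a continuous composition semigroup of probability generating functions (pgfs) of $\mathbb{N}_0$-valued random variables: every $F_s$ is a non-constant pgf, $F_s\circ F_t=F_{s+t}$ for $s,t\ge 0$, $F_0=I$ and $\lim_{s\downarrow 0}F_s=F_0$ pointwise, where $I(z)=z$. Assume that $F_t\ne I$ for $t>0$ and that $F_1'(1)=e^{-1}$. Let $$G(z)=\lim_{t\to\infty}\frac{F_t(z)-F_t(0)}{1-F_t(0)},\qquad 0\le z\le 1$$ (the limit exists and $G$ is a pgf). Let $N=\{N(t),\,t\ge 0\}$ be the compound Poisson process with rate $1$ and jump pgf $G$, that is, $N(t)=W_1+\cdots+W_{N_1(t)}$, where $N_1$ is a unit rate Poisson process with right-continuous paths and $W_1,W_2,\dots$ are independent random variables with pgf $G$, independent of $N_1$. An $F$-branching process is a continuous-time Markov branching process $Z=\{Z(t),\,t\ge 0\}$ with right-continuous paths such that $Z(0)=1$ a.s. and $Z(s)$ has pgf $F_s$ for every $s\ge 0$. Let $A$ be a $(0,1)$-valued random variable independent of $N$. Let $Z_1,Z_2,\dots$ be independent $F$-branching processes such that the sequence $(Z_i)_{i\ge1}$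 is independent of $N$ and $A$ is independent of the pair $(N,(Z_i)_{i\ge1})$, and put $$A\odot_F N(t)=Z_1(-\log A)+\cdots+Z_{N(t)}(-\log A),\qquad t\ge 0.$$ Then the processes $\{N(At),\,t\ge 0\}$ and $\{A\odot_F N(t),\,t\ge 0\}$ have the same finite-dimensional distributions. -/

import Mathlib

open MeasureTheory ProbabilityTheory Filter Topology
open scoped NNReal

namespace IntThinning

/-- `f` is, on `[0, 1]`, the probability generating function (pgf) of a probability distribution
on `ℕ = {0, 1, 2, …}`. -/
def IsPGF (f : ℝ → ℝ) : Prop :=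
  ∃ p : PMF ℕ, ∀ z ∈ Set.Icc (0 : ℝ) 1, f z = ∑' n : ℕ, (p n).toReal * z ^ n

/-- `F = (F_s)_{s ≥ 0}` is a continuous composition semigroup of non-constant pgfs, normalized by
`F_t ≠ I` for `t > 0` and `F_1'(1) = e^{-1}` (the derivative at `1` being the left derivative).
Only the values on `[0, 1]` matter; they determine the pgfs. -/
structure IsThinningSemigroup (F : ℝ≥0 → ℝ → ℝ) : Prop where
  isPGF : ∀ s, IsPGF (F s)
  nonconstant : ∀ s, ¬ ∃ c : ℝ, ∀ z ∈ Set.Icc (0 : ℝ) 1, F s z = c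
  comp : ∀ s t, ∀ z ∈ Set.Icc (0 : ℝ) 1, F s (F t z) = F (s + t) z
  zero : ∀ z ∈ Set.Icc (0 : ℝ) 1, F 0 z = z
  tendsto_zero : ∀ z ∈ Set.Icc (0 : ℝ) 1, Tendsto (fun s : ℝ≥0 ↦ F s z) (𝓝[>] 0) (𝓝 z)
  ne_id : ∀ t, 0 < t → ∃ z ∈ Set.Icc (0 : ℝ) 1, F t z ≠ z
  deriv_one : HasDerivWithinAt (F 1) (Real.exp (-1)) (Set.Icc 0 1) 1

/-- The function `G(z) = lim_{t → ∞} (F_t(z) - F_t(0)) / (1 - F_t(0))`, `0 ≤ z ≤ 1`.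
For every `F` with `IsThinningSemigroup F` the limit exists for all `z ∈ [0, 1]`. -/
noncomputable def limitPGF (F : ℝ≥0 → ℝ → ℝ) (z : ℝ) : ℝ :=
  limUnder atTop (fun t : ℝ≥0 ↦ (F t z - F t 0) / (1 - F t 0))

variable {Ω Ω' : Type*} [MeasurableSpace Ω] [MeasurableSpace Ω']

/-- Almost all sample paths of the `ℕ`-valued process `X` are right-continuous. -/
def HasRightContPaths (X : ℝ≥0 → Ω → ℕ) (P : Measure Ω) : Prop :=
  ∀ᵐ ω ∂P, ∀ t, ContinuousWithinAt (fun u ↦ X u ω) (Set.Ici t) t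

/-- Unit rate Poisson (counting) process: it starts at `0`, has nondecreasing right-continuous
paths and independent increments, and `N₁(t) - N₁(s)` is Poisson with mean `t - s` for `s ≤ t`.
(The paths being nondecreasing, the subtraction of natural numbers is the true one.) -/
structure IsUnitPoissonProcess (N₁ : ℝ≥0 → Ω → ℕ) (P : Measure Ω) : Prop where
  measurable : ∀ t, Measurable (N₁ t)
  zero : ∀ᵐ ω ∂P, N₁ 0 ω = 0
  mono : ∀ᵐ ω ∂P, Monotone (fun t ↦ N₁ t ω)
  rightCont : HasRightContPaths N₁ P
  indep : HasIndepIncrements N₁ P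
  law : ∀ s t, s ≤ t → HasLaw (fun ω ↦ N₁ t ω - N₁ s ω) (poissonMeasure (t - s)) P

/-- `N` is a compound Poisson process with rate `1` whose jumps have the pgf `G`:
`N(t) = W_1 + ⋯ + W_{N₁(t)}` with `N₁` a unit rate Poisson process and `W_1, W_2, …` independent
with pgf `G` and independent of `N₁`. -/
def IsUnitCompoundPoisson (G : ℝ → ℝ) (N : ℝ≥0 → Ω → ℕ) (P : Measure Ω) : Prop :=
  ∃ (N₁ : ℝ≥0 → Ω → ℕ) (W : ℕ → Ω → ℕ),
    IsUnitPoissonProcess N₁ P ∧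
    (∀ i, Measurable (W i)) ∧
    iIndepFun W P ∧
    (∀ i, ∀ z ∈ Set.Icc (0 : ℝ) 1, ∫ ω, z ^ W i ω ∂P = G z) ∧
    IndepFun (fun ω t ↦ N₁ t ω) (fun ω i ↦ W i ω) P ∧
    ∀ t ω, N t ω = ∑ i ∈ Finset.range (N₁ t ω), W i ω

/-- `Z` is an `F`-branching process: a continuous-time Markov branching process with right-continuous
paths, `Z(0) = 1` a.s. and `Z(t)` having pgf `F_t`. The field `branching` is the Markov
property together with the branching property: given the past up to time `s`, `Z(s + t)` is
distributed as a sum of `Z(s)` independent variables with pgf `F_t`. -/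
structure IsBranchingProcess (F : ℝ≥0 → ℝ → ℝ) (Z : ℝ≥0 → Ω → ℕ) (P : Measure Ω) : Prop where
  measurable : ∀ t, Measurable (Z t)
  rightCont : HasRightContPaths Z P
  zero : ∀ᵐ ω ∂P, Z 0 ω = 1
  pgf : ∀ t, ∀ z ∈ Set.Icc (0 : ℝ) 1, ∫ ω, z ^ Z t ω ∂P = F t z
  branching : ∀ s t, ∀ z ∈ Set.Icc (0 : ℝ) 1,
    P[fun ω ↦ z ^ Z (s + t) ω | ⨆ u ∈ Set.Iic s, MeasurableSpace.comap (Z u) ⊤]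
      =ᵐ[P] fun ω ↦ F t z ^ Z s ω

/-- The data used to form `A ⊙_F X`: independent `F`-branching processes `Z_1, Z_2, …`
(indexed from `0` here), independent of `X`, and a `(0, 1)`-valued random variable `A`
independent of `X` and `Z_1, Z_2, …`. -/
structure IsThinningData (F : ℝ≥0 → ℝ → ℝ) (Z : ℕ → ℝ≥0 → Ω → ℕ) (A : Ω → ℝ≥0)
    (X : ℝ≥0 → Ω → ℕ) (P : Measure Ω) : Prop where
  branching : ∀ i, IsBranchingProcess F (Z i) P
  indep : iIndepFun (fun i ω t ↦ Z i t ω) P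
  indep_process : IndepFun (fun ω t ↦ X t ω) (fun ω i t ↦ Z i t ω) P
  measurable : Measurable A
  mem_Ioo : ∀ᵐ ω ∂P, A ω ∈ Set.Ioo (0 : ℝ≥0) 1
  indep_multiplier : IndepFun A (fun ω ↦ ((fun t ↦ X t ω), (fun i t ↦ Z i t ω))) P

/-- The process `A ⊙_F X`, with `(A ⊙_F X)(t) = Z_1(-log A) + ⋯ + Z_{X(t)}(-log A)`. -/
noncomputable def thin (Z : ℕ → ℝ≥0 → Ω → ℕ) (A : Ω → ℝ≥0) (X : ℝ≥0 → Ω → ℕ) :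
    ℝ≥0 → Ω → ℕ :=
  fun t ω ↦ ∑ i ∈ Finset.range (X t ω), Z i (-Real.log (A ω)).toNNReal ω

/-- Equality of the finite-dimensional distributions of two processes. -/
def EqFDD (X : ℝ≥0 → Ω → ℕ) (P : Measure Ω) (Y : ℝ≥0 → Ω' → ℕ) (Q : Measure Ω') : Prop :=
  ∀ (n : ℕ) (t : Fin n → ℝ≥0),
    IdentDistrib (fun ω i ↦ X (t i) ω) (fun ω i ↦ Y (t i) ω) P Q

end IntThinning

/-!
Conditionally on `A = a`, write `b = -log a`. A compound Poisson process has independent increments,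
and its increment over an interval of length `t` has pgf `exp (-t (1 - G z))`. Running it at speed
`a` gives `exp (-a t (1 - G z))`; replacing every unit by an independent copy of `Z(b)`, whose pgf
is `F_b`, gives `exp (-t (1 - G (F_b z)))`. These agree because of the functional equation
`1 - G (F_b z) = exp (-b) (1 - G z)` (`IsThinningSemigroup.one_sub_limitPGF_comp`).

For the functional equation, let `leftSlope f w = (1 - f w) / (1 - w)`, which increases in `w`
when `f` is a pgf. The identity `leftSlope F_{s+t} w = leftSlope F_s (F_t w) * leftSlope F_t w`
makes the left derivatives at `1` multiplicative in time, and right-continuity of `F` together with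
`F_1'(1) = exp (-1)` forces them to be `exp (-s)` (`IsThinningSemigroup.tendsto_leftSlope`). The
same identity shows that `(1 - F_t z) / (1 - F_t 0)` increases with `t`, so that the limit defining `G`
exists; replacing `z` by `F_s z` multiplies this ratio by `leftSlope F_s (F_t z)`, which tends to
`exp (-s)` as `F_t z → 1`.

The joint pgf of the increments of a random sum is computed in `integral_prod_pow_sum_range`, which
serves both for `N` as a random sum of its jumps and for the thinned process as a random sum over
`N`. Joint pgfs determine laws on `ℕ ^ n` (`ext_of_integral_prod_pow`), which settles a
deterministic multiplier (`eqFDD_of_const_multiplier`). Finally, the law of a right-continuous process at an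
independent random time is the mixture of its laws at fixed times (`integral_randomTime`); this is
used for `a ↦ N (a t)` at time `A` and for the thinned process at time `-log A`.
-/

namespace IntThinning

/-! ### Approximation of times from above -/

/-- The least multiple of `1 / (n + 1)` that is strictly larger than `s`. Being strictly larger
lets it be used with limits along `𝓝[>] s`. -/
noncomputable def upperApprox (n : ℕ) (s : ℝ≥0) : ℝ≥0 :=
  ((⌊s * (n + 1)⌋₊ + 1 : ℕ) : ℝ≥0) * (1 / (n + 1 : ℝ≥0))

lemma lt_upperApprox (n : ℕ) (s : ℝ≥0) : s < upperApprox n s := by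
  have := Nat.lt_floor_add_one (s * (n + 1))
  simp only [upperApprox, mul_one_div]
  rw [lt_div_iff₀ (by positivity)]
  exact_mod_cast this

lemma upperApprox_le (n : ℕ) (s : ℝ≥0) : upperApprox n s ≤ s + 1 / (n + 1) := by
  have := Nat.floor_le (bot_le : 0 ≤ s * (n + 1 : ℝ≥0))
  simp only [upperApprox, mul_one_div, Nat.cast_succ]
  rw [div_le_iff₀ (by positivity), add_mul, one_div_mul_cancel (by positivity)]
  gcongr

lemma tendsto_upperApprox (s : ℝ≥0) : Tendsto (fun n ↦ upperApprox n s) atTop (𝓝[>] s) := by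
  refine tendsto_nhdsWithin_iff.2 ⟨?_, Eventually.of_forall fun n ↦ lt_upperApprox n s⟩
  refine tendsto_of_tendsto_of_tendsto_of_le_of_le tendsto_const_nhds ?_
    (fun n ↦ (lt_upperApprox n s).le) fun n ↦ upperApprox_le n s
  simpa using (tendsto_one_div_add_atTop_nhds_zero_nat (𝕜 := ℝ≥0)).const_add s

/-! ### Probability generating functions -/

lemma hasSum_toReal_pmf (p : PMF ℕ) : HasSum (fun n ↦ (p n).toReal) 1 := by
  have h := ENNReal.hasSum_toReal (f := fun n ↦ p n) (by rw [p.tsum_coe]; simp)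
  simpa [p.tsum_coe, ← ENNReal.tsum_toReal_eq (fun n ↦ p.apply_ne_top n)] using h

lemma summable_pmf_mul_pow (p : PMF ℕ) {z : ℝ} (hz : z ∈ Set.Icc (0 : ℝ) 1) :
    Summable fun n ↦ (p n).toReal * z ^ n :=
  Summable.of_nonneg_of_le (fun _ ↦ mul_nonneg ENNReal.toReal_nonneg (pow_nonneg hz.1 _))
    (fun _ ↦ mul_le_of_le_one_right ENNReal.toReal_nonneg (pow_le_one₀ hz.1 hz.2))
    (hasSum_toReal_pmf p).summable

lemma IsPGF.one {f : ℝ → ℝ} (hf : IsPGF f) : f 1 = 1 := by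
  obtain ⟨p, hp⟩ := hf
  rw [hp 1 (by simp)]
  simpa using (hasSum_toReal_pmf p).tsum_eq

lemma IsPGF.monotoneOn {f : ℝ → ℝ} (hf : IsPGF f) : MonotoneOn f (Set.Icc 0 1) := by
  obtain ⟨p, hp⟩ := hf
  intro z hz w hw hzw
  rw [hp z hz, hp w hw]
  exact (summable_pmf_mul_pow p hz).tsum_le_tsum
    (fun n ↦ mul_le_mul_of_nonneg_left (pow_le_pow_left₀ hz.1 hzw n) ENNReal.toReal_nonneg)
    (summable_pmf_mul_pow p hw)

lemma IsPGF.mem_Icc {f : ℝ → ℝ} (hf : IsPGF f) {z : ℝ} (hz : z ∈ Set.Icc (0 : ℝ) 1) :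
    f z ∈ Set.Icc (0 : ℝ) 1 := by
  refine ⟨?_, hf.one ▸ hf.monotoneOn hz (by simp) hz.2⟩
  obtain ⟨p, hp⟩ := hf
  rw [hp z hz]
  exact tsum_nonneg fun _ ↦ mul_nonneg ENNReal.toReal_nonneg (pow_nonneg hz.1 _)

/-- The slope of the chord of the graph of `f` over `[w, 1]`, for a function with `f 1 = 1`. -/
noncomputable def leftSlope (f : ℝ → ℝ) (w : ℝ) : ℝ := (1 - f w) / (1 - w)

lemma IsPGF.hasSum_one_sub {f : ℝ → ℝ} {p : PMF ℕ}
    (hp : ∀ z ∈ Set.Icc (0 : ℝ) 1, f z = ∑' n : ℕ, (p n).toReal * z ^ n)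
    {z : ℝ} (hz : z ∈ Set.Icc (0 : ℝ) 1) :
    HasSum (fun n ↦ (p n).toReal * (1 - z ^ n)) (1 - f z) := by
  rw [hp z hz]
  simpa [mul_sub] using (hasSum_toReal_pmf p).sub (summable_pmf_mul_pow p hz).hasSum

/-- The chord slopes at `1` increase, because a pgf is convex on `[0, 1]`. -/
lemma IsPGF.monotoneOn_leftSlope {f : ℝ → ℝ} (hf : IsPGF f) :
    MonotoneOn (leftSlope f) (Set.Ico 0 1) := by
  obtain ⟨p, hp⟩ := hf
  intro z hz w hw hzw
  have key {x : ℝ} (hx : x ∈ Set.Ico (0 : ℝ) 1) :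
      HasSum (fun n ↦ (p n).toReal * ∑ k ∈ Finset.range n, x ^ k) (leftSlope f x) := by
    have h := (IsPGF.hasSum_one_sub hp ⟨hx.1, hx.2.le⟩).div_const (1 - x)
    have e : (fun n ↦ (p n).toReal * (1 - x ^ n) / (1 - x)) =
        fun n ↦ (p n).toReal * ∑ k ∈ Finset.range n, x ^ k := by
      funext n
      rw [geom_sum_eq hx.2.ne, mul_div_assoc, ← neg_div_neg_eq, neg_sub, neg_sub]
    rwa [e] at h
  refine hasSum_le (fun n ↦ mul_le_mul_of_nonneg_left (Finset.sum_le_sum fun k _ ↦ ?_)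
    ENNReal.toReal_nonneg) (key hz) (key hw)
  exact pow_le_pow_left₀ hz.1 hzw k

lemma IsPGF.lt_one {f : ℝ → ℝ} (hf : IsPGF f)
    (hc : ¬ ∃ c : ℝ, ∀ z ∈ Set.Icc (0 : ℝ) 1, f z = c) {z : ℝ} (hz : z ∈ Set.Ico (0 : ℝ) 1) :
    f z < 1 := by
  refine lt_of_le_of_ne (hf.mem_Icc ⟨hz.1, hz.2.le⟩).2 fun h ↦ hc ⟨1, fun w hw ↦ ?_⟩
  obtain ⟨p, hp⟩ := hf
  have h0 := IsPGF.hasSum_one_sub hp ⟨hz.1, hz.2.le⟩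
  rw [h, sub_self, hasSum_zero_iff_of_nonneg
    (fun n ↦ mul_nonneg ENNReal.toReal_nonneg (sub_nonneg.2 (pow_le_one₀ hz.1 hz.2.le)))] at h0
  have h1 := IsPGF.hasSum_one_sub hp hw
  have h2 : (fun n ↦ (p n).toReal * (1 - w ^ n)) = fun _ ↦ 0 := by
    funext n
    rcases eq_or_ne n 0 with rfl | hn
    · simp
    · have := congrFun h0 n
      rcases mul_eq_zero.1 this with h | h
      · simp [h]
      · exact absurd h (sub_pos.2 (pow_lt_one₀ hz.1 hz.2 hn)).ne'
  rw [h2] at h1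
  linarith [h1.unique hasSum_zero]

/-! ### Derivatives at `1` in a composition semigroup -/

namespace IsThinningSemigroup

variable {F : ℝ≥0 → ℝ → ℝ}

lemma mem_Ico (hF : IsThinningSemigroup F) (s : ℝ≥0) {z : ℝ} (hz : z ∈ Set.Ico (0 : ℝ) 1) :
    F s z ∈ Set.Ico (0 : ℝ) 1 :=
  ⟨((hF.isPGF s).mem_Icc ⟨hz.1, hz.2.le⟩).1, (hF.isPGF s).lt_one (hF.nonconstant s) hz⟩

lemma leftSlope_pos (hF : IsThinningSemigroup F) (s : ℝ≥0) {z : ℝ}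
    (hz : z ∈ Set.Ico (0 : ℝ) 1) : 0 < leftSlope (F s) z :=
  div_pos (sub_pos.2 (hF.mem_Ico s hz).2) (sub_pos.2 hz.2)

lemma leftSlope_add (hF : IsThinningSemigroup F) (s t : ℝ≥0) {z : ℝ}
    (hz : z ∈ Set.Ico (0 : ℝ) 1) :
    leftSlope (F (s + t)) z = leftSlope (F s) (F t z) * leftSlope (F t) z := by
  have h1 := sub_pos.2 hz.2
  have h2 := sub_pos.2 (hF.mem_Ico t hz).2
  rw [leftSlope, leftSlope, leftSlope, ← hF.comp s t z ⟨hz.1, hz.2.le⟩]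
  field_simp

lemma tendsto_leftSlope_one (hF : IsThinningSemigroup F) :
    Tendsto (leftSlope (F 1)) (𝓝[<] 1) (𝓝 (Real.exp (-1))) := by
  have h := hasDerivWithinAt_iff_tendsto_slope.1 hF.deriv_one
  rw [Set.Icc_sdiff_right] at h
  rw [← nhdsWithin_Ico_eq_nhdsLT (zero_lt_one (α := ℝ))]
  refine h.congr fun z ↦ ?_
  rw [slope_def_field, (hF.isPGF 1).one, leftSlope, ← neg_div_neg_eq, neg_sub, neg_sub]

/-- Chord slopes lie below their limit at `1`. -/
lemma leftSlope_le_of_tendsto (hF : IsThinningSemigroup F) {s : ℝ≥0} {m z : ℝ}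
    (h : Tendsto (leftSlope (F s)) (𝓝[<] 1) (𝓝 m)) (hz : z ∈ Set.Ico (0 : ℝ) 1) :
    leftSlope (F s) z ≤ m := by
  refine ge_of_tendsto h ?_
  filter_upwards [Ico_mem_nhdsLT hz.2] with w hw
  exact (hF.isPGF s).monotoneOn_leftSlope hz ⟨hz.1.trans hw.1, hw.2⟩ hw.1

lemma leftSlope_natCast_le (hF : IsThinningSemigroup F) (n : ℕ) {z : ℝ}
    (hz : z ∈ Set.Ico (0 : ℝ) 1) : leftSlope (F n) z ≤ Real.exp (-n) := by
  induction n with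
  | zero =>
    have := sub_pos.2 hz.2
    simp [leftSlope, hF.zero z ⟨hz.1, hz.2.le⟩, this.ne']
  | succ n ih =>
    rw [Nat.cast_succ, add_comm, hF.leftSlope_add 1 n hz, Nat.cast_succ, neg_add, add_comm,
      Real.exp_add]
    exact mul_le_mul (hF.leftSlope_le_of_tendsto hF.tendsto_leftSlope_one (hF.mem_Ico _ hz)) ih
      (hF.leftSlope_pos _ hz).le (Real.exp_pos _).le

/-- Every `F s` has a finite left derivative at `1`: the slopes of `F n` are bounded for natural
numbers `n ≥ s`, and `leftSlope_add` bounds those of `F s` by them. -/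
lemma exists_tendsto_leftSlope (hF : IsThinningSemigroup F) (s : ℝ≥0) :
    ∃ m, 0 < m ∧ Tendsto (leftSlope (F s)) (𝓝[<] 1) (𝓝 m) := by
  obtain ⟨n, hn⟩ := exists_nat_ge s
  have h0 : (0 : ℝ) ∈ Set.Ico (0 : ℝ) 1 := by simp
  have hb : ∀ z ∈ Set.Ico (0 : ℝ) 1,
      leftSlope (F s) z ≤ Real.exp (-n) / leftSlope (F (n - s)) 0 := by
    intro z hz
    rw [le_div_iff₀ (hF.leftSlope_pos _ h0), mul_comm]
    have h1 := hF.leftSlope_natCast_le n hz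
    rw [← tsub_add_cancel_of_le hn, hF.leftSlope_add _ _ hz] at h1
    refine le_trans (mul_le_mul_of_nonneg_right ?_ (hF.leftSlope_pos _ hz).le) h1
    exact (hF.isPGF _).monotoneOn_leftSlope h0 (hF.mem_Ico _ hz) (hF.mem_Ico _ hz).1
  have hmono := (hF.isPGF s).monotoneOn_leftSlope
  have ht : ∃ m, Tendsto (leftSlope (F s)) (𝓝[<] 1) (𝓝 m) := by
    refine ⟨_, MonotoneOn.tendsto_nhdsWithin_Ioo_left (Set.nonempty_Ioo.2 zero_lt_one)
      (hmono.mono Set.Ioo_subset_Ico_self) ?_⟩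
    refine ⟨Real.exp (-n) / leftSlope (F (n - s)) 0, ?_⟩
    rintro _ ⟨z, hz, rfl⟩
    exact hb z ⟨hz.1.le, hz.2⟩
  obtain ⟨m, hm⟩ := ht
  exact ⟨m, (hF.leftSlope_pos s h0).trans_le (hF.leftSlope_le_of_tendsto hm h0), hm⟩

lemma tendsto_nhdsLT_one (hF : IsThinningSemigroup F) (s : ℝ≥0) :
    Tendsto (F s) (𝓝[<] 1) (𝓝[<] 1) := by
  obtain ⟨m, -, hm⟩ := hF.exists_tendsto_leftSlope s
  refine tendsto_nhdsWithin_iff.2 ⟨?_, ?_⟩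
  · have h1 : Tendsto (fun w : ℝ ↦ 1 - w) (𝓝[<] 1) (𝓝 (1 - 1)) :=
      (continuous_const.sub continuous_id).continuousAt.tendsto.mono_left nhdsWithin_le_nhds
    have h2 := (hm.mul h1).const_sub 1
    rw [sub_self, mul_zero, sub_zero] at h2
    refine h2.congr' ?_
    filter_upwards [self_mem_nhdsWithin] with w (hw : w < 1)
    rw [leftSlope, div_mul_cancel₀ _ (sub_pos.2 hw).ne', sub_sub_cancel]
  · filter_upwards [Ico_mem_nhdsLT (zero_lt_one (α := ℝ))] with w hw
    exact (hF.mem_Ico s hw).2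

lemma tendsto_leftSlope_add (hF : IsThinningSemigroup F) {s t : ℝ≥0} {m m' : ℝ}
    (hs : Tendsto (leftSlope (F s)) (𝓝[<] 1) (𝓝 m))
    (ht : Tendsto (leftSlope (F t)) (𝓝[<] 1) (𝓝 m')) :
    Tendsto (leftSlope (F (s + t))) (𝓝[<] 1) (𝓝 (m * m')) := by
  refine ((hs.comp (hF.tendsto_nhdsLT_one t)).mul ht).congr' ?_
  filter_upwards [Ico_mem_nhdsLT (zero_lt_one (α := ℝ))] with w hw
  exact (hF.leftSlope_add s t hw).symm

lemma tendsto_leftSlope_nat_mul (hF : IsThinningSemigroup F) {s : ℝ≥0} {m : ℝ}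
    (hs : Tendsto (leftSlope (F s)) (𝓝[<] 1) (𝓝 m)) (n : ℕ) :
    Tendsto (leftSlope (F (n * s))) (𝓝[<] 1) (𝓝 (m ^ n)) := by
  induction n with
  | zero =>
    refine tendsto_const_nhds.congr' ?_
    filter_upwards [Ico_mem_nhdsLT (zero_lt_one (α := ℝ))] with w hw
    have := sub_pos.2 hw.2
    simp [leftSlope, hF.zero w ⟨hw.1, hw.2.le⟩, this.ne']
  | succ n ih =>
    rw [Nat.cast_succ, add_mul, one_mul, pow_succ]
    exact hF.tendsto_leftSlope_add ih hs

lemma tendsto_leftSlope_div (hF : IsThinningSemigroup F) (k n : ℕ) :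
    Tendsto (leftSlope (F (k * (1 / (n + 1 : ℝ≥0))))) (𝓝[<] 1)
      (𝓝 (Real.exp (-(k * (1 / (n + 1)) : ℝ≥0)))) := by
  obtain ⟨m, hm0, hm⟩ := hF.exists_tendsto_leftSlope (1 / (n + 1 : ℝ≥0))
  have h1 := hF.tendsto_leftSlope_nat_mul hm (n + 1)
  have h2 : ((n + 1 : ℕ) : ℝ≥0) * (1 / (n + 1 : ℝ≥0)) = 1 := by
    push_cast
    exact mul_one_div_cancel (by positivity)
  rw [h2] at h1
  have h3 := tendsto_nhds_unique h1 hF.tendsto_leftSlope_one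
  have h4 : m = Real.exp (-(1 / (n + 1))) := by
    refine (pow_left_inj₀ hm0.le (Real.exp_pos _).le n.succ_ne_zero).1 (h3.trans ?_)
    rw [← Real.exp_nat_mul]
    congr 1
    push_cast
    field_simp
  have h5 := hF.tendsto_leftSlope_nat_mul hm k
  rw [h4, ← Real.exp_nat_mul] at h5
  convert h5 using 3
  push_cast
  ring

/-- For fixed `z`, the map `s ↦ F s z` is right-continuous, so bounds at rational times pass to
real times from above. -/
lemma leftSlope_le (hF : IsThinningSemigroup F) (s : ℝ≥0) {z : ℝ}
    (hz : z ∈ Set.Ico (0 : ℝ) 1) : leftSlope (F s) z ≤ Real.exp (-s) := by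
  let q : ℕ → ℝ≥0 := fun n ↦ upperApprox n s
  have hq1 (n : ℕ) : s < q n := lt_upperApprox n s
  have hq : Tendsto q atTop (𝓝 s) := (tendsto_upperApprox s).mono_right nhdsWithin_le_nhds
  have hh : Tendsto (fun n ↦ q n - s) atTop (𝓝[>] 0) := by
    refine tendsto_nhdsWithin_iff.2 ⟨?_, Eventually.of_forall fun n ↦ tsub_pos_of_lt (hq1 n)⟩
    simpa using hq.sub_const s
  have hF1 : Tendsto (fun n ↦ F (q n) z) atTop (𝓝 (F s z)) := by
    refine ((hF.tendsto_zero _ ((hF.isPGF s).mem_Icc ⟨hz.1, hz.2.le⟩)).comp hh).congr fun n ↦ ?_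
    rw [Function.comp_apply, hF.comp _ _ z ⟨hz.1, hz.2.le⟩, tsub_add_cancel_of_le (hq1 n).le]
  refine le_of_tendsto_of_tendsto' ((hF1.const_sub 1).div_const (1 - z))
    (((Real.continuous_exp.comp continuous_neg).tendsto (s : ℝ)).comp
      ((NNReal.continuous_coe.tendsto s).comp hq)) fun n ↦ ?_
  exact hF.leftSlope_le_of_tendsto (hF.tendsto_leftSlope_div _ n) hz

/-- The left derivative of `F s` at `1` is `exp (-s)`. -/
lemma tendsto_leftSlope (hF : IsThinningSemigroup F) (s : ℝ≥0) :
    Tendsto (leftSlope (F s)) (𝓝[<] 1) (𝓝 (Real.exp (-s))) := by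
  have hle (t : ℝ≥0) {m : ℝ} (hm : Tendsto (leftSlope (F t)) (𝓝[<] 1) (𝓝 m)) :
      m ≤ Real.exp (-t) := by
    refine le_of_tendsto hm ?_
    filter_upwards [Ico_mem_nhdsLT (zero_lt_one (α := ℝ))] with w hw using hF.leftSlope_le t hw
  obtain ⟨n, hn⟩ := exists_nat_ge s
  obtain ⟨m, hm0, hm⟩ := hF.exists_tendsto_leftSlope s
  obtain ⟨m', hm0', hm'⟩ := hF.exists_tendsto_leftSlope (n - s)
  -- The product of the derivatives at times `s` and `n - s` is `exp (-n)`, and neither factor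
  -- exceeds its bound, so both bounds are attained.
  have h1 := hF.tendsto_leftSlope_add hm hm'
  rw [add_tsub_cancel_of_le hn] at h1
  have h2 : m * m' = Real.exp (-n) := by
    refine tendsto_nhds_unique h1 ?_
    have := hF.tendsto_leftSlope_nat_mul hF.tendsto_leftSlope_one n
    rw [mul_one, ← Real.exp_nat_mul] at this
    simpa using this
  have h3 := hle _ hm
  have h4 := hle _ hm'
  have h5 : Real.exp (-n) = Real.exp (-s) * Real.exp (-(n - s : ℝ≥0)) := by
    rw [← Real.exp_add, NNReal.coe_sub hn]
    congr 1
    push_cast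
    ring
  have h6 : Real.exp (-s) ≤ m := by
    by_contra hlt
    push Not at hlt
    have := mul_lt_mul hlt h4 hm0' (Real.exp_pos _).le
    linarith
  rwa [le_antisymm h3 h6] at hm

/-! ### The limiting pgf -/

lemma tendsto_atTop (hF : IsThinningSemigroup F) {z : ℝ} (hz : z ∈ Set.Ico (0 : ℝ) 1) :
    Tendsto (fun t ↦ F t z) atTop (𝓝[<] 1) := by
  refine tendsto_nhdsWithin_iff.2 ⟨?_, Eventually.of_forall fun t ↦ (hF.mem_Ico t hz).2⟩
  have h1 : Tendsto (fun t : ℝ≥0 ↦ 1 - Real.exp (-t)) atTop (𝓝 1) := by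
    simpa using ((Real.tendsto_exp_neg_atTop_nhds_zero.comp
      (NNReal.tendsto_coe_atTop.2 tendsto_id)).const_sub (1 : ℝ))
  refine tendsto_of_tendsto_of_tendsto_of_le_of_le h1 tendsto_const_nhds (fun t ↦ ?_)
    (fun t ↦ (hF.mem_Ico t hz).2.le)
  have h2 := hF.leftSlope_le t hz
  rw [leftSlope, div_le_iff₀ (sub_pos.2 hz.2)] at h2
  have : Real.exp (-t) * (1 - z) ≤ Real.exp (-t) :=
    mul_le_of_le_one_right (Real.exp_pos _).le (by linarith [hz.1])
  show 1 - Real.exp (-t) ≤ F t z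
  linarith

/-- The ratios defining `1 - G z` increase with time, by monotonicity of the chord slopes. -/
lemma monotone_ratio (hF : IsThinningSemigroup F) {z : ℝ} (hz : z ∈ Set.Ico (0 : ℝ) 1) :
    Monotone fun t ↦ (1 - F t z) / (1 - F t 0) := by
  have h0 : (0 : ℝ) ∈ Set.Ico (0 : ℝ) 1 := by simp
  intro s t hst
  have e (x : ℝ) (hx : x ∈ Set.Ico (0 : ℝ) 1) :
      1 - F t x = leftSlope (F (t - s)) (F s x) * (1 - F s x) := by
    rw [leftSlope, div_mul_cancel₀ _ (sub_pos.2 (hF.mem_Ico s hx).2).ne',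
      hF.comp _ _ x ⟨hx.1, hx.2.le⟩, tsub_add_cancel_of_le hst]
  have hp := hF.leftSlope_pos (t - s) (hF.mem_Ico s h0)
  have h1 := sub_pos.2 (hF.mem_Ico s h0).2
  have h2 := sub_pos.2 (hF.mem_Ico s hz).2
  have hm := (hF.isPGF (t - s)).monotoneOn_leftSlope (hF.mem_Ico s h0) (hF.mem_Ico s hz)
    ((hF.isPGF s).monotoneOn ⟨h0.1, h0.2.le⟩ ⟨hz.1, hz.2.le⟩ hz.1)
  show (1 - F s z) / (1 - F s 0) ≤ (1 - F t z) / (1 - F t 0)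
  rw [e z hz, e 0 h0, div_le_div_iff₀ h1 (mul_pos hp h1)]
  nlinarith [mul_le_mul_of_nonneg_right hm (mul_pos h1 h2).le]

lemma tendsto_limitPGF (hF : IsThinningSemigroup F) {z : ℝ} (hz : z ∈ Set.Icc (0 : ℝ) 1) :
    Tendsto (fun t ↦ (1 - F t z) / (1 - F t 0)) atTop (𝓝 (1 - limitPGF F z)) := by
  have h0 : (0 : ℝ) ∈ Set.Ico (0 : ℝ) 1 := by simp
  have hpos (t : ℝ≥0) := sub_pos.2 (hF.mem_Ico t h0).2
  have hex : ∃ l, Tendsto (fun t ↦ (1 - F t z) / (1 - F t 0)) atTop (𝓝 l) := by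
    rcases hz.2.eq_or_lt with rfl | hz1
    · exact ⟨0, by simp [(hF.isPGF _).one]⟩
    · refine ⟨_, tendsto_atTop_ciSup (hF.monotone_ratio ⟨hz.1, hz1⟩) ⟨1, ?_⟩⟩
      rintro _ ⟨t, rfl⟩
      refine (div_le_one (hpos t)).2 (sub_le_sub_left ?_ 1)
      exact (hF.isPGF t).monotoneOn ⟨h0.1, h0.2.le⟩ hz hz.1
  obtain ⟨l, hl⟩ := hex
  have h1 : Tendsto (fun t ↦ (F t z - F t 0) / (1 - F t 0)) atTop (𝓝 (1 - l)) := by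
    refine (hl.const_sub 1).congr fun t ↦ ?_
    have := hpos t
    field_simp
    ring
  rwa [limitPGF, h1.limUnder_eq, sub_sub_cancel]

/-- The functional equation of the limiting pgf. -/
lemma one_sub_limitPGF_comp (hF : IsThinningSemigroup F) (s : ℝ≥0) {z : ℝ}
    (hz : z ∈ Set.Icc (0 : ℝ) 1) :
    1 - limitPGF F (F s z) = Real.exp (-s) * (1 - limitPGF F z) := by
  refine tendsto_nhds_unique (hF.tendsto_limitPGF ((hF.isPGF s).mem_Icc hz)) ?_
  rcases hz.2.eq_or_lt with rfl | hz1
  · have := tendsto_nhds_unique (hF.tendsto_limitPGF hz)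
      (tendsto_const_nhds.congr fun t ↦ by rw [(hF.isPGF t).one, sub_self, zero_div])
    simp [this, (hF.isPGF _).one]
  · have hz' : z ∈ Set.Ico (0 : ℝ) 1 := ⟨hz.1, hz1⟩
    refine (((hF.tendsto_leftSlope s).comp (hF.tendsto_atTop hz')).mul
      (hF.tendsto_limitPGF hz)).congr fun t ↦ ?_
    have h2 := (sub_pos.2 (hF.mem_Ico t hz').2).ne'
    rw [Function.comp_apply, leftSlope, hF.comp s t z hz, hF.comp t s z hz, add_comm t s]
    field_simp

end IsThinningSemigroup

/-! ### Joint pgfs of increments -/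

section Increments

variable {Ω : Type*} [MeasurableSpace Ω] {P : Measure Ω}

/-- Fubini's theorem for the joint law of independent variables, stated on the sample space. -/
lemma integral_indepFun_pair [IsProbabilityMeasure P] {α β : Type*} [MeasurableSpace α]
    [MeasurableSpace β]
    {U : Ω → α} {V : Ω → β} (hU : Measurable U) (hV : Measurable V) (h : IndepFun U V P)
    {f : α × β → ℝ} (hf : Measurable f) {C : ℝ} (hC : ∀ x, ‖f x‖ ≤ C) :
    ∫ ω, f (U ω, V ω) ∂P = ∫ ω, ∫ ω', f (U ω, V ω') ∂P ∂P := by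
  have := Measure.isProbabilityMeasure_map (μ := P) hU.aemeasurable
  have := Measure.isProbabilityMeasure_map (μ := P) hV.aemeasurable
  have h1 : ∫ ω, f (U ω, V ω) ∂P = ∫ x, f x ∂(P.map fun ω ↦ (U ω, V ω)) :=
    (integral_map (hU.prodMk hV).aemeasurable hf.aestronglyMeasurable).symm
  rw [h1, (indepFun_iff_map_prod_eq_prod_map_map hU.aemeasurable hV.aemeasurable).1 h,
    integral_prod _ (Integrable.of_bound hf.aestronglyMeasurable C (Eventually.of_forall hC)),
    integral_map hU.aemeasurable hf.stronglyMeasurable.integral_prod_right'.aestronglyMeasurable]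
  refine integral_congr_ae (Eventually.of_forall fun ω ↦ ?_)
  exact integral_map hV.aemeasurable (hf.comp measurable_prodMk_left).aestronglyMeasurable

lemma integral_pow_poissonMeasure (r : ℝ≥0) (z : ℝ) :
    ∫ n, z ^ n ∂(poissonMeasure r) = Real.exp (-(r * (1 - z))) := by
  have h := NormedSpace.expSeries_div_hasSum_exp (𝔸 := ℝ) (r * z)
  rw [← Real.exp_eq_exp_ℝ] at h
  rw [integral_poissonMeasure, mul_sub, mul_one, neg_sub, sub_eq_add_neg, add_comm, Real.exp_add,
    ← (h.mul_left (Real.exp (-r))).tsum_eq]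
  refine tsum_congr fun n ↦ ?_
  rw [smul_eq_mul, mul_pow]
  ring

lemma IsUnitPoissonProcess.integral_prod_pow {N₁ : ℝ≥0 → Ω → ℕ}
    (hN : IsUnitPoissonProcess N₁ P) {m : ℕ} {s : Fin (m + 1) → ℝ≥0} (hs : Monotone s)
    (z : Fin m → ℝ) :
    ∫ ω, ∏ i, z i ^ (N₁ (s i.succ) ω - N₁ (s i.castSucc) ω) ∂P =
      ∏ i : Fin m, Real.exp (-((s i.succ - s i.castSucc : ℝ≥0) * (1 - z i))) := by
  have hlaw (i : Fin m) := hN.law _ _ (hs (Fin.castSucc_lt_succ (i := i)).le)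
  have h := (hN.indep m s hs).integral_fun_prod_comp (f := fun i n ↦ z i ^ n)
    (fun i ↦ (hlaw i).aemeasurable) fun i ↦ (measurable_of_countable _).aestronglyMeasurable
  refine h.trans (Finset.prod_congr rfl fun i _ ↦ ?_)
  rw [← integral_pow_poissonMeasure, ← (hlaw i).map_eq, integral_map (hlaw i).aemeasurable
    (measurable_of_countable _).aestronglyMeasurable]

lemma norm_prod_pow_le_one {n : ℕ} {z : Fin n → ℝ} (hz : ∀ i, z i ∈ Set.Icc (0 : ℝ) 1)
    (x : Fin n → ℕ) : ‖∏ i, z i ^ x i‖ ≤ 1 := by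
  rw [Real.norm_of_nonneg (Finset.prod_nonneg fun i _ ↦ pow_nonneg (hz i).1 _)]
  exact Finset.prod_le_one (fun i _ ↦ pow_nonneg (hz i).1 _)
    fun i _ ↦ pow_le_one₀ (hz i).1 (hz i).2

/-- Sums of independent variables over consecutive blocks are independent. -/
lemma integral_prod_pow_sum_Ico {Y : ℕ → Ω → ℕ} (hY : ∀ k, Measurable (Y k))
    (hYi : iIndepFun Y P) {m : ℕ} {z c : Fin m → ℝ} (hc : ∀ i k, ∫ ω, z i ^ Y k ω ∂P = c i)
    {n : Fin (m + 1) → ℕ} (hn : Monotone n) :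
    ∫ ω, ∏ i : Fin m, z i ^ (∑ k ∈ Finset.Ico (n i.castSucc) (n i.succ), Y k ω) ∂P =
      ∏ i : Fin m, c i ^ (n i.succ - n i.castSucc) := by
  have hinj : Function.Injective 
      fun p : (i : Fin m) × Finset.Ico (n i.castSucc) (n i.succ) ↦ (p.2 : ℕ) := by
    have key (i j : Fin m) (hij : i < j) (x y : ℕ) (hx : x < n i.succ) (hy : n j.castSucc ≤ y) :
        x ≠ y :=
      ((hx.trans_le (hn (Fin.succ_le_castSucc_iff.2 hij))).trans_le hy).ne
    rintro ⟨i, x, hx⟩ ⟨j, y, hy⟩ (h : x = y)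
    rw [Finset.mem_Ico] at hx hy
    subst h
    rcases lt_trichotomy i j with hij | rfl | hij
    · exact absurd rfl (key i j hij x x hx.2 hy.1)
    · rfl
    · exact absurd rfl (key j i hij x x hy.2 hx.1)
  have h := (hYi.precomp hinj).integral_fun_prod_comp (f := fun p n ↦ z p.1 ^ n)
    (fun p ↦ (hY _).aemeasurable) fun i ↦ (measurable_of_countable _).aestronglyMeasurable
  simp only [hc, Fintype.prod_sigma, Finset.prod_const, Finset.card_univ, Fintype.card_coe,
    Nat.card_Ico] at h
  rw [← h]
  refine integral_congr_ae (Eventually.of_forall fun ω ↦ Finset.prod_congr rfl fun i _ ↦ ?_)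
  rw [← Finset.prod_pow_eq_pow_sum, ← Finset.prod_coe_sort]

/-- Joint pgf of the increments of a random sum: conditionally on the numbers `K i` of summands,
an increment is a sum of `K i.succ - K i.castSucc` independent variables. -/
lemma integral_prod_pow_sum_range [IsProbabilityMeasure P] {Y : ℕ → Ω → ℕ}
    (hY : ∀ k, Measurable (Y k)) (hYi : iIndepFun Y P) {m : ℕ} {K : Fin (m + 1) → Ω → ℕ}
    (hK : ∀ i, Measurable (K i))
    (hKm : ∀ᵐ ω ∂P, Monotone fun i ↦ K i ω)
    (hKY : IndepFun (fun ω i ↦ K i ω) (fun ω k ↦ Y k ω) P)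
    {z c : Fin m → ℝ} (hz : ∀ i, z i ∈ Set.Icc (0 : ℝ) 1)
    (hc : ∀ i k, ∫ ω, z i ^ Y k ω ∂P = c i) :
    ∫ ω, ∏ i : Fin m, z i ^ (∑ k ∈ Finset.range (K i.succ ω), Y k ω
      - ∑ k ∈ Finset.range (K i.castSucc ω), Y k ω) ∂P =
      ∫ ω, ∏ i : Fin m, c i ^ (K i.succ ω - K i.castSucc ω) ∂P := by
  let f : (Fin (m + 1) → ℕ) × (ℕ → ℕ) → ℝ := fun x ↦ ∏ i : Fin m, z i ^
    (∑ k ∈ Finset.range (x.1 i.succ), x.2 k - ∑ k ∈ Finset.range (x.1 i.castSucc), x.2 k)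
  have hf : Measurable f := by
    refine measurable_from_prod_countable_right fun n ↦ ?_
    simp only [f]
    refine Finset.measurable_prod _ fun i _ ↦
      (measurable_of_countable fun j : ℕ ↦ z i ^ j).comp ?_
    fun_prop
  have hb (x) : ‖f x‖ ≤ 1 := norm_prod_pow_le_one hz _
  refine (integral_indepFun_pair (measurable_pi_lambda _ hK) (measurable_pi_lambda _ hY) hKY
    hf hb).trans (integral_congr_ae ?_)
  filter_upwards [hKm] with ω hω
  rw [← integral_prod_pow_sum_Ico hY hYi hc hω]
  refine integral_congr_ae (Eventually.of_forall fun ω' ↦ Finset.prod_congr rfl fun i _ ↦ ?_)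
  have := Finset.sum_range_add_sum_Ico (fun k ↦ Y k ω') (hω (Fin.castSucc_lt_succ (i := i)).le)
  simp only at this ⊢
  rw [← this, Nat.add_sub_cancel_left]

/-! ### Joint pgfs determine the law -/

/-- The monomial `x ↦ ∏ i, z i ^ x i` on `ℕ ^ n`, for `z` in the unit cube. -/
noncomputable def boundedMonomial {n : ℕ} (z : Fin n → Set.Icc (0 : ℝ) 1) :
    BoundedContinuousFunction (Fin n → ℕ) ℝ :=
  BoundedContinuousFunction.ofNormedAddCommGroup (fun x ↦ ∏ i, (z i : ℝ) ^ x i)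
    continuous_of_discreteTopology 1 (norm_prod_pow_le_one fun i ↦ (z i).2)

lemma boundedMonomial_apply {n : ℕ} (z : Fin n → Set.Icc (0 : ℝ) 1) (x : Fin n → ℕ) :
    boundedMonomial z x = ∏ i, (z i : ℝ) ^ x i := rfl

/-- The monomials are closed under multiplication and separate points, so by the
Stone–Weierstrass theorem their integrals determine a finite measure. -/
lemma ext_of_integral_prod_pow {n : ℕ} {μ ν : Measure (Fin n → ℕ)} [IsFiniteMeasure μ]
    [IsFiniteMeasure ν]
    (h : ∀ z : Fin n → ℝ, (∀ i, z i ∈ Set.Icc (0 : ℝ) 1) →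
      ∫ x, ∏ i, z i ^ x i ∂μ = ∫ x, ∏ i, z i ^ x i ∂ν) : μ = ν := by
  let M : Submonoid (BoundedContinuousFunction (Fin n → ℕ) ℝ) :=
    { carrier := Set.range boundedMonomial
      one_mem' := ⟨fun _ ↦ 1, by ext x; simp [boundedMonomial_apply]⟩
      mul_mem' := by
        rintro _ _ ⟨z, rfl⟩ ⟨w, rfl⟩
        refine ⟨fun i ↦ z i * w i, ?_⟩
        ext x
        simp [boundedMonomial_apply, mul_pow, Finset.prod_mul_distrib] }
  let A : StarSubalgebra ℝ (BoundedContinuousFunction (Fin n → ℕ) ℝ) :=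
    { Algebra.adjoin ℝ (M : Set _) with
      star_mem' := fun {a} ha ↦ by
        have : star a = a := by ext; simp
        rwa [this] }
  refine ext_of_forall_mem_subalgebra_integral_eq_of_polish (𝕜 := ℝ) (A := A) ?_ fun g hg ↦ ?_
  · intro x y hxy
    obtain ⟨i, hi⟩ := Function.ne_iff.1 hxy
    let z : Fin n → Set.Icc (0 : ℝ) 1 :=
      fun j ↦ if j = i then ⟨1 / 2, by norm_num⟩ else ⟨1, by norm_num⟩
    have hz (x : Fin n → ℕ) : boundedMonomial z x = (1 / 2) ^ x i := by
      rw [boundedMonomial_apply, Finset.prod_eq_single i]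
      · simp [z]
      · intro j _ hj
        simp [z, hj]
      · simp
    refine ⟨_, ⟨_, ⟨boundedMonomial z, Algebra.subset_adjoin ⟨z, rfl⟩, rfl⟩, rfl⟩, ?_⟩
    show boundedMonomial z x ≠ boundedMonomial z y
    rw [hz, hz]
    exact fun h ↦ hi (pow_right_injective₀ (by norm_num) (by norm_num) h)
  · have hg' : g ∈ Subalgebra.toSubmodule (Algebra.adjoin ℝ (M : Set _)) := hg
    rw [Algebra.adjoin_eq_span, Submonoid.closure_eq] at hg'
    clear hg
    induction hg' using Submodule.span_induction with
    | mem x hx =>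
      obtain ⟨z, rfl⟩ := hx
      exact h _ fun i ↦ (z i).2
    | zero => simp
    | add x y _ _ hx hy =>
      simp only [BoundedContinuousFunction.coe_add, Pi.add_apply]
      rw [integral_add (x.integrable _) (y.integrable _),
        integral_add (x.integrable _) (y.integrable _), hx, hy]
    | smul a x _ hx =>
      simp only [BoundedContinuousFunction.coe_smul, integral_smul, hx]

/-- Two nondecreasing processes started at `0` have the same finite-dimensional distributions if
their increments have the same joint pgfs. -/
lemma eqFDD_of_increments [IsProbabilityMeasure P] {X Y : ℝ≥0 → Ω → ℕ}
    (hX : ∀ t, Measurable (X t)) (hY : ∀ t, Measurable (Y t))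
    (hXm : ∀ᵐ ω ∂P, Monotone fun t ↦ X t ω)
    (hYm : ∀ᵐ ω ∂P, Monotone fun t ↦ Y t ω) (hX0 : ∀ᵐ ω ∂P, X 0 ω = 0)
    (hY0 : ∀ᵐ ω ∂P, Y 0 ω = 0)
    (h : ∀ (m : ℕ) (s : Fin (m + 1) → ℝ≥0), Monotone s →
      ∀ z : Fin m → ℝ, (∀ i, z i ∈ Set.Icc (0 : ℝ) 1) →
      ∫ ω, ∏ i, z i ^ (X (s i.succ) ω - X (s i.castSucc) ω) ∂P =
        ∫ ω, ∏ i, z i ^ (Y (s i.succ) ω - Y (s i.castSucc) ω) ∂P) :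
    EqFDD X P Y P := by
  intro n t
  -- Sort the times and put `0` in front: the values are then partial sums of the increments.
  let σ := Tuple.sort t
  let s : Fin (n + 1) → ℝ≥0 := Fin.cons 0 (t ∘ σ)
  have hs : Monotone s := by
    have h2 : Monotone (t ∘ σ) := Tuple.monotone_sort t
    intro i j hij
    cases i using Fin.cases with
    | zero => exact bot_le
    | succ i =>
      cases j using Fin.cases with
      | zero => exact absurd hij (Fin.succ_pos i).not_ge
      | succ j => exact h2 (Fin.succ_le_succ_iff.1 hij)
  let D (X : ℝ≥0 → Ω → ℕ) (ω : Ω) (i : Fin n) : ℕ := X (s i.succ) ω - X (s i.castSucc) ω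
  have hD {X : ℝ≥0 → Ω → ℕ} (hX : ∀ t, Measurable (X t)) : Measurable (D X) :=
    measurable_pi_lambda _ fun i ↦ (hX _).sub (hX _)
  let r (d : Fin n → ℕ) (i : Fin n) : ℕ := Fin.partialSum d (σ.symm i).succ
  have hr {X : ℝ≥0 → Ω → ℕ} (hXm : ∀ᵐ ω ∂P, Monotone fun t ↦ X t ω)
      (hX0 : ∀ᵐ ω ∂P, X 0 ω = 0) : (fun ω i ↦ X (t i) ω) =ᵐ[P] fun ω ↦ r (D X ω) := by
    filter_upwards [hXm, hX0] with ω hm h0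
    have key (j : Fin (n + 1)) : Fin.partialSum (D X ω) j = X (s j) ω := by
      induction j using Fin.induction with
      | zero => simp [s, h0]
      | succ i ih =>
        rw [Fin.partialSum_succ, ih]
        exact Nat.add_sub_cancel' (hm (hs (Fin.castSucc_lt_succ (i := i)).le))
    funext i
    simp only [r, key]
    simp [s]
  have hlaw : IdentDistrib (D X) (D Y) P P := by
    refine ⟨(hD hX).aemeasurable, (hD hY).aemeasurable, ?_⟩
    have := Measure.isFiniteMeasure_map P (D X)
    have := Measure.isFiniteMeasure_map P (D Y)
    refine ext_of_integral_prod_pow fun z hz ↦ ?_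
    rw [integral_map (hD hX).aemeasurable (measurable_of_countable _).aestronglyMeasurable,
      integral_map (hD hY).aemeasurable (measurable_of_countable _).aestronglyMeasurable]
    exact h n s hs z hz
  have h1 : IdentDistrib (fun ω ↦ r (D X ω)) (fun ω ↦ r (D Y ω)) P P :=
    hlaw.comp (measurable_of_countable r)
  have h2 : IdentDistrib (fun ω i ↦ X (t i) ω) (fun ω ↦ r (D X ω)) P P :=
    IdentDistrib.of_ae_eq (measurable_pi_lambda _ fun i ↦ hX _).aemeasurable (hr hXm hX0)
  have h3 : IdentDistrib (fun ω i ↦ Y (t i) ω) (fun ω ↦ r (D Y ω)) P P :=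
    IdentDistrib.of_ae_eq (measurable_pi_lambda _ fun i ↦ hY _).aemeasurable (hr hYm hY0)
  exact (h2.trans h1).trans h3.symm

/-! ### Processes at an independent random time -/

section RandomTime

variable {n : ℕ} {Y : ℝ≥0 → Ω → Fin n → ℕ} {B : Ω → ℝ≥0}

lemma ae_eventually_eq_upperApprox
    (hYr : ∀ᵐ ω ∂P, ∀ t, ContinuousWithinAt (fun u ↦ Y u ω) (Set.Ici t) t) (s : Ω → ℝ≥0) :
    ∀ᵐ ω ∂P, ∀ᶠ k in atTop, Y (upperApprox k (s ω)) ω = Y (s ω) ω := by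
  filter_upwards [hYr] with ω hω
  have h := (hω (s ω)).tendsto.comp
    ((tendsto_upperApprox (s ω)).mono_right (nhdsWithin_mono _ Set.Ioi_subset_Ici_self))
  rw [nhds_discrete, tendsto_pure] at h
  exact h

lemma measurable_comp_upperApprox (hY : ∀ t, Measurable (Y t)) (hB : Measurable B) (k : ℕ) :
    Measurable fun ω ↦ Y (upperApprox k (B ω)) ω := by
  have h : Measurable fun x : Ω × ℕ ↦ Y (((x.2 + 1 : ℕ) : ℝ≥0) * (1 / (k + 1 : ℝ≥0))) x.1 :=
    measurable_from_prod_countable_left fun j ↦ hY (((j + 1 : ℕ) : ℝ≥0) * (1 / (k + 1 : ℝ≥0)))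
  exact h.comp (measurable_id.prodMk (Nat.measurable_floor.comp (hB.mul_const _)))

lemma aemeasurable_randomTime (hY : ∀ t, Measurable (Y t))
    (hYr : ∀ᵐ ω ∂P, ∀ t, ContinuousWithinAt (fun u ↦ Y u ω) (Set.Ici t) t)
    (hB : Measurable B) : AEMeasurable (fun ω ↦ Y (B ω) ω) P := by
  refine aemeasurable_of_tendsto_metrizable_ae atTop
    (fun k ↦ (measurable_comp_upperApprox hY hB k).aemeasurable) ?_
  filter_upwards [ae_eventually_eq_upperApprox hYr B] with ω hω
  exact tendsto_const_nhds.congr' (hω.mono fun k hk ↦ hk.symm)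

/-- The law of a right-continuous process at an independent random time is the mixture of its laws
at fixed times. The time is approximated by discrete ones, for which this follows from
independence alone. -/
lemma integral_randomTime [IsProbabilityMeasure P] (hY : ∀ t, Measurable (Y t))
    (hYr : ∀ᵐ ω ∂P, ∀ t, ContinuousWithinAt (fun u ↦ Y u ω) (Set.Ici t) t)
    (hB : Measurable B) (hBY : IndepFun B (fun ω t ↦ Y t ω) P)
    {f : (Fin n → ℕ) → ℝ} {C : ℝ} (hC : ∀ x, ‖f x‖ ≤ C) :
    ∫ ω, f (Y (B ω) ω) ∂P = ∫ ω, ∫ ω', f (Y (B ω) ω') ∂P ∂P := by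
  have hf : Measurable f := measurable_of_countable f
  have htime (k : ℕ) : ∫ ω, f (Y (upperApprox k (B ω)) ω) ∂P =
      ∫ ω, ∫ ω', f (Y (upperApprox k (B ω)) ω') ∂P ∂P := by
    let T (j : ℕ) : ℝ≥0 := ((j + 1 : ℕ) : ℝ≥0) * (1 / (k + 1 : ℝ≥0))
    have hfl : Measurable fun b : ℝ≥0 ↦ ⌊b * (k + 1)⌋₊ :=
      Nat.measurable_floor.comp (measurable_id.mul_const _)
    have hV : Measurable fun (y : ℝ≥0 → Fin n → ℕ) (j : ℕ) ↦ y (T j) :=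
      measurable_pi_lambda _ fun j ↦ measurable_pi_apply _
    exact integral_indepFun_pair (f := fun x : ℕ × (ℕ → Fin n → ℕ) ↦ f (x.2 x.1))
      (hfl.comp hB) (hV.comp (measurable_pi_lambda _ hY)) (hBY.comp hfl hV)
      (measurable_from_prod_countable_right fun j ↦ hf.comp (measurable_pi_apply j))
      fun x ↦ hC _
  have hmeas (k : ℕ) := hf.comp (measurable_comp_upperApprox hY hB k)
  refine tendsto_nhds_unique
    (tendsto_integral_of_dominated_convergence (F := fun k ω ↦ f (Y (upperApprox k (B ω)) ω))
      (fun _ ↦ C) (fun k ↦ (hmeas k).aestronglyMeasurable) (integrable_const C)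
      (fun k ↦ Eventually.of_forall fun ω ↦ hC _) ?_) ?_
  · filter_upwards [ae_eventually_eq_upperApprox hYr B] with ω hω
    exact tendsto_const_nhds.congr' (hω.mono fun k hk ↦ (congrArg f hk).symm)
  · simp only [htime]
    refine tendsto_integral_of_dominated_convergence (fun _ ↦ C) (fun k ↦ ?_) (integrable_const C)
      (fun k ↦ Eventually.of_forall fun ω ↦ ?_) (Eventually.of_forall fun ω ↦ ?_)
    · exact ((measurable_of_countable fun j : ℕ ↦ ∫ ω', f (Y (((j + 1 : ℕ) : ℝ≥0) *
        (1 / (k + 1 : ℝ≥0))) ω') ∂P).comp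
        (Nat.measurable_floor.comp (hB.mul_const _))).aestronglyMeasurable
    · simpa using norm_integral_le_of_norm_le_const (μ := P)
        (Eventually.of_forall fun ω' ↦ hC (Y (upperApprox k (B ω)) ω'))
    · refine tendsto_integral_of_dominated_convergence (fun _ ↦ C)
        (fun k ↦ (hf.comp (hY _)).aestronglyMeasurable) (integrable_const C)
        (fun k ↦ Eventually.of_forall fun ω ↦ hC _) ?_
      filter_upwards [ae_eventually_eq_upperApprox hYr fun _ ↦ B ω] with ω' hω'
      exact tendsto_const_nhds.congr' (hω'.mono fun k hk ↦ (congrArg f hk).symm)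

end RandomTime

end Increments

/-! ### Compound Poisson processes and their thinnings -/

section CompoundPoisson

variable {Ω : Type*} [MeasurableSpace Ω] {P : Measure Ω}

lemma measurable_sum_range {K : Ω → ℕ} (hK : Measurable K) {Y : ℕ → Ω → ℕ}
    (hY : ∀ k, Measurable (Y k)) : Measurable fun ω ↦ ∑ k ∈ Finset.range (K ω), Y k ω := by
  have h : Measurable fun x : ℕ × Ω ↦ ∑ k ∈ Finset.range x.1, Y k x.2 :=
    measurable_from_prod_countable_right fun n ↦
      Finset.measurable_sum (Finset.range n) fun k _ ↦ hY k
  exact h.comp (hK.prodMk measurable_id)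

lemma monotone_sum_range (y : ℕ → ℕ) : Monotone fun n ↦ ∑ k ∈ Finset.range n, y k :=
  fun _ _ h ↦ Finset.sum_le_sum_of_subset (Finset.range_mono h)

namespace IsUnitCompoundPoisson

variable {G : ℝ → ℝ} {N : ℝ≥0 → Ω → ℕ}

lemma measurable (hN : IsUnitCompoundPoisson G N P) (t : ℝ≥0) : Measurable (N t) := by
  obtain ⟨N₁, W, h1, hW, -, -, -, h⟩ := hN
  rw [funext (h t)]
  exact measurable_sum_range (h1.measurable t) hW

lemma zero (hN : IsUnitCompoundPoisson G N P) : ∀ᵐ ω ∂P, N 0 ω = 0 := by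
  obtain ⟨N₁, W, h1, -, -, -, -, h⟩ := hN
  filter_upwards [h1.zero] with ω hω
  simp [h, hω]

lemma mono (hN : IsUnitCompoundPoisson G N P) : ∀ᵐ ω ∂P, Monotone fun t ↦ N t ω := by
  obtain ⟨N₁, W, h1, -, -, -, -, h⟩ := hN
  filter_upwards [h1.mono] with ω hω
  simp only [h]
  exact (monotone_sum_range _).comp hω

lemma rightCont (hN : IsUnitCompoundPoisson G N P) : HasRightContPaths N P := by
  obtain ⟨N₁, W, h1, -, -, -, -, h⟩ := hN
  filter_upwards [h1.rightCont] with ω hω t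
  simp only [h]
  exact (continuous_of_discreteTopology
    (f := fun n ↦ ∑ k ∈ Finset.range n, W k ω)).continuousAt.comp_continuousWithinAt (hω t)

lemma integral_prod_pow [IsProbabilityMeasure P] (hN : IsUnitCompoundPoisson G N P) {m : ℕ}
    {s : Fin (m + 1) → ℝ≥0} (hs : Monotone s) {z : Fin m → ℝ}
    (hz : ∀ i, z i ∈ Set.Icc (0 : ℝ) 1) :
    ∫ ω, ∏ i, z i ^ (N (s i.succ) ω - N (s i.castSucc) ω) ∂P =
      ∏ i : Fin m, Real.exp (-((s i.succ - s i.castSucc : ℝ≥0) * (1 - G (z i)))) := by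
  obtain ⟨N₁, W, h1, hW, hWi, hWG, hind, h⟩ := hN
  rw [← h1.integral_prod_pow hs]
  simp only [h]
  refine integral_prod_pow_sum_range hW hWi (K := fun i ↦ N₁ (s i)) (fun i ↦ h1.measurable _) ?_
    (hind.comp (measurable_pi_lambda _ fun i ↦ measurable_pi_apply (s i)) measurable_id) hz
    fun i k ↦ hWG k _ (hz i)
  filter_upwards [h1.mono] with ω hω
  exact hω.comp hs

end IsUnitCompoundPoisson

/-- The theorem for a deterministic multiplier `exp (-b)`. In the joint pgf of its increments,
scaling the time of `N` turns the factor `t * (1 - G z)` of the exponent into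
`t * exp (-b) * (1 - G z)`, while thinning turns it into `t * (1 - G (F b z))`. -/
lemma eqFDD_of_const_multiplier [IsProbabilityMeasure P] {F : ℝ≥0 → ℝ → ℝ}
    (hF : IsThinningSemigroup F) {N : ℝ≥0 → Ω → ℕ}
    (hN : IsUnitCompoundPoisson (limitPGF F) N P) {Z : ℕ → ℝ≥0 → Ω → ℕ}
    (hZ : ∀ k, IsBranchingProcess F (Z k) P) (hZi : iIndepFun (fun k ω t ↦ Z k t ω) P)
    (hNZ : IndepFun (fun ω t ↦ N t ω) (fun ω k t ↦ Z k t ω) P) {a b : ℝ≥0}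
    (hab : Real.exp (-b) = a) :
    EqFDD (fun t ω ↦ N (a * t) ω) P (fun t ω ↦ ∑ k ∈ Finset.range (N t ω), Z k b ω) P := by
  have hscale : Monotone fun t : ℝ≥0 ↦ a * t := fun _ _ h ↦ mul_le_mul_right h a
  refine eqFDD_of_increments (fun t ↦ hN.measurable _)
    (fun t ↦ measurable_sum_range (hN.measurable t) fun k ↦ (hZ k).measurable b)
    ?_ ?_ ?_ ?_ fun m s hs z hz ↦ ?_
  · filter_upwards [hN.mono] with ω hω using hω.comp hscale
  · filter_upwards [hN.mono] with ω hω using (monotone_sum_range _).comp hω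
  · simpa using hN.zero
  · filter_upwards [hN.zero] with ω hω
    simp [hω]
  · have hN_times : Measurable fun (x : ℝ≥0 → ℕ) (i : Fin (m + 1)) ↦ x (s i) :=
      measurable_pi_lambda _ fun i ↦ measurable_pi_apply (s i)
    have hZ_time : Measurable fun (x : ℕ → ℝ≥0 → ℕ) (k : ℕ) ↦ x k b :=
      measurable_pi_lambda _ fun k ↦ (measurable_pi_apply b).comp (measurable_pi_apply k)
    have hthin := integral_prod_pow_sum_range (P := P) (Y := fun k ω ↦ Z k b ω)
      (fun k ↦ (hZ k).measurable b) (hZi.comp (fun _ x ↦ x b) fun _ ↦ measurable_pi_apply b)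
      (K := fun i ↦ N (s i)) (fun i ↦ hN.measurable _)
      (by filter_upwards [hN.mono] with ω hω using hω.comp hs)
      (hNZ.comp hN_times hZ_time)
      hz fun i k ↦ (hZ k).pgf b _ (hz i)
    rw [hthin, hN.integral_prod_pow hs fun i ↦ (hF.isPGF b).mem_Icc (hz i)]
    refine (hN.integral_prod_pow (hscale.comp hs) hz).trans (Finset.prod_congr rfl fun i _ ↦ ?_)
    rw [hF.one_sub_limitPGF_comp b (hz i), hab]
    simp only [Function.comp_apply, ← mul_tsub]
    push_cast
    congr 1
    ring

end CompoundPoisson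

end IntThinning

theorem lemma2 {Ω : Type*} [MeasurableSpace Ω] (P : Measure Ω) [IsProbabilityMeasure P]
    (F : ℝ≥0 → ℝ → ℝ) (hF : IntThinning.IsThinningSemigroup F)
    (N : ℝ≥0 → Ω → ℕ) (hN : IntThinning.IsUnitCompoundPoisson (IntThinning.limitPGF F) N P)
    (Z : ℕ → ℝ≥0 → Ω → ℕ) (A : Ω → ℝ≥0) (hZA : IntThinning.IsThinningData F Z A N P) :
    IntThinning.EqFDD (fun t ω ↦ N (A ω * t) ω) P (IntThinning.thin Z A N) P := by
  intro n t
  let B : Ω → ℝ≥0 := fun ω ↦ (-Real.log (A ω)).toNNReal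
  let Y : ℝ≥0 → Ω → Fin n → ℕ := fun a ω i ↦ N (a * t i) ω
  let Y' : ℝ≥0 → Ω → Fin n → ℕ := fun b ω i ↦ ∑ k ∈ Finset.range (N (t i) ω), Z k b ω
  have hlog : Measurable fun a : ℝ≥0 ↦ (-Real.log a).toNNReal :=
    (Real.measurable_log.comp measurable_subtype_coe).neg.real_toNNReal
  have hB : Measurable B := hlog.comp hZA.measurable
  have hY (a : ℝ≥0) : Measurable (Y a) := measurable_pi_lambda _ fun i ↦ hN.measurable _
  have hY' (b : ℝ≥0) : Measurable (Y' b) := measurable_pi_lambda _ fun i ↦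
    IntThinning.measurable_sum_range (hN.measurable _) fun k ↦ (hZA.branching k).measurable b
  have hYr : ∀ᵐ ω ∂P, ∀ a, ContinuousWithinAt (fun u ↦ Y u ω) (Set.Ici a) a := by
    filter_upwards [hN.rightCont] with ω hω a
    refine continuousWithinAt_pi.2 fun i ↦ ?_
    exact ContinuousWithinAt.comp (f := fun u ↦ u * t i) (hω (a * t i))
      (continuous_id.mul continuous_const).continuousWithinAt
      fun u hu ↦ mul_le_mul_left hu (t i)
  have hYr' : ∀ᵐ ω ∂P, ∀ b, ContinuousWithinAt (fun u ↦ Y' u ω) (Set.Ici b) b := by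
    filter_upwards [ae_all_iff.2 fun k ↦ (hZA.branching k).rightCont] with ω hω b
    exact continuousWithinAt_pi.2 fun i ↦ tendsto_finsetSum _ fun k _ ↦ hω k b
  have hindY : IndepFun A (fun ω a ↦ Y a ω) P :=
    hZA.indep_multiplier.comp (φ := id) (ψ := fun x a i ↦ x.1 (a * t i)) measurable_id
      (measurable_pi_lambda _ fun a ↦ measurable_pi_lambda _ fun i ↦
        (measurable_pi_apply (a * t i)).comp measurable_fst)
  have hsum : Measurable fun (x : (ℝ≥0 → ℕ) × (ℕ → ℝ≥0 → ℕ)) (b : ℝ≥0) (i : Fin n) ↦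
      ∑ k ∈ Finset.range (x.1 (t i)), x.2 k b :=
    measurable_pi_lambda _ fun b ↦ measurable_pi_lambda _ fun i ↦
      IntThinning.measurable_sum_range ((measurable_pi_apply (t i)).comp measurable_fst)
        fun k ↦ (measurable_pi_apply b).comp ((measurable_pi_apply k).comp measurable_snd)
  have hindY' : IndepFun B (fun ω b ↦ Y' b ω) P := hZA.indep_multiplier.comp hlog hsum
  have haY := IntThinning.aemeasurable_randomTime hY hYr hZA.measurable
  have haY' := IntThinning.aemeasurable_randomTime hY' hYr' hB
  have hfixed : ∀ᵐ ω ∂P, IdentDistrib (Y (A ω)) (Y' (B ω)) P P := by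
    filter_upwards [hZA.mem_Ioo] with ω hω
    refine IntThinning.eqFDD_of_const_multiplier hF hN hZA.branching hZA.indep
      hZA.indep_process ?_ n t
    -- The truncation in `toNNReal` is harmless because `A ω < 1`.
    have h0 : (0 : ℝ) < A ω := NNReal.coe_pos.2 hω.1
    have h1 : (A ω : ℝ) ≤ 1 := NNReal.coe_le_one.2 hω.2.le
    rw [Real.coe_toNNReal _ (neg_nonneg.2 (Real.log_nonpos h0.le h1)), neg_neg, Real.exp_log h0]
  refine ⟨haY, haY', ?_⟩
  have := Measure.isFiniteMeasure_map P fun ω ↦ Y (A ω) ω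
  have := Measure.isFiniteMeasure_map P fun ω ↦ Y' (B ω) ω
  refine IntThinning.ext_of_integral_prod_pow (μ := P.map fun ω ↦ Y (A ω) ω)
    (ν := P.map fun ω ↦ Y' (B ω) ω) fun z hz ↦ ?_
  have hmeas : Measurable fun x : Fin n → ℕ ↦ ∏ i, z i ^ x i := measurable_of_countable _
  have hbound := IntThinning.norm_prod_pow_le_one hz
  rw [integral_map haY hmeas.aestronglyMeasurable, integral_map haY' hmeas.aestronglyMeasurable,
    IntThinning.integral_randomTime hY hYr hZA.measurable hindY hbound,
    IntThinning.integral_randomTime hY' hYr' hB hindY' hbound]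
  refine integral_congr_ae ?_
  filter_upwards [hfixed] with ω hω
  exact (hω.comp hmeas).integral_eq
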